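/- Let $q$ be a power of an odd prime $p$, let $m$ be an odd positive integer with $(q,m)\neq(3,1)$, let $\kappa\ge 0$ be an integer, and put $n=q^m-1$. Let $\alpha$ be a generator of $\mathrm{GF}(q^m)^*$, let $\mathrm{Tr}$ be the trace from $\mathrm{GF}(q^m)$ to $\mathrm{GF}(q)$, and let $f(x)=x^{q^\kappa+1}$ (the Dembowski–Ostrom planar function on $\mathrm{GF}(q^m)$). Define $s_i=\mathrm{Tr}(f(\alpha^i+1))$ for $i\ge 0$ and $S(x)=\sum_{i=0}^{n-1}s_ix^i$, and let $\mathcal C_s$ be the code of length $n$ over $\mathrm{GF}(q)$ corresponding to the ideal of $\mathrm{GF}(q)[x]/(x^n-1)$ generated by $(x^n-1)/\gcd(S(x),x^n-1)$. Let $m_a(x)$ be the minimal polynomial of $a$ over $\mathrm{GF}(q)$, and let $\mathbb N_p(m)=0$ if $p\mid m$ and $\mathbb N_p(m)=1$ otherwise. Then $\mathcal C_s$ is a cyclic code with parameters $[n,\,n-2m-\mathbb N_p(m),\,d]$ and generator polynomial $$(x-1)^{\mathbb N_p(m)}\,m_{\alpha^{-1}}(x)\,m_{\alpha^{-(q^\kappa+1)}}(x),$$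 where $$\begin{cases} d=4 & \text{if } q=3 \text{ and } m\equiv 0 \pmod p,\\ 4\le d\le 5 & \text{if } q=3 \text{ and } m\not\equiv 0 \pmod p,\\ d=3 & \text{if } q>3 \text{ and } m\equiv 0 \pmod p,\\ 3\le d\le 4 & \text{if } q>3 \text{ and } m\not\equiv 0 \pmod p.\end{cases}$$ -/

import Mathlib

open Polynomial

/-- `ℕ_p(i)` is `0` if `p` divides `i`, and `1` otherwise. -/
def Np (p i : ℕ) : ℕ := if p ∣ i then 0 else 1

/-- The Dembowski–Ostrom function `x ↦ x ^ (q ^ κ + 1)`. -/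
def demOstrom (K : Type*) [Field K] (q κ : ℕ) (x : K) : K := x ^ (q ^ κ + 1)

/-- The sequence `s_i = Tr (f (α ^ i + 1))` over `F`, where `f` is a function on the extension
field `K` and `Tr` is the trace from `K` to `F`. -/
noncomputable def assocSeq (F : Type*) {K : Type*} [Field F] [Field K] [Algebra F K]
    (f : K → K) (α : K) (i : ℕ) : F :=
  Algebra.trace F K (f (α ^ i + 1))

section Codes

variable {F : Type*} [Field F]

/-- The polynomial `S(x) = s_0 + s_1 x + ⋯ + s_{n-1} x ^ (n - 1)`. -/
noncomputable def seqPoly (n : ℕ) (s : ℕ → F) : F[X] :=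
  ∑ i ∈ Finset.range n, C (s i) * X ^ i

open Classical in
/-- The polynomial `(x ^ n - 1) / gcd (S(x), x ^ n - 1)`, made monic. -/
noncomputable def seqGenPoly (n : ℕ) (s : ℕ → F) : F[X] :=
  normalize ((X ^ n - 1) / EuclideanDomain.gcd (seqPoly n s) (X ^ n - 1))

/-- The ring `F[x] / (x ^ n - 1)`. -/
abbrev CyclicRing (F : Type*) [Field F] (n : ℕ) : Type _ :=
  F[X] ⧸ Ideal.span {(X ^ n - 1 : F[X])}

/-- The class of a polynomial in `F[x] / (x ^ n - 1)`. -/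
noncomputable def toCyclicRing (n : ℕ) : F[X] →ₐ[F] CyclicRing F n :=
  Ideal.Quotient.mkₐ F (Ideal.span {(X ^ n - 1 : F[X])})

/-- The word `(c_0, …, c_{n-1})` seen as the class of `c_0 + c_1 x + ⋯ + c_{n-1} x ^ (n - 1)`
in `F[x] / (x ^ n - 1)`. -/
noncomputable def wordClass (n : ℕ) : (Fin n → F) →ₗ[F] CyclicRing F n :=
  (toCyclicRing n).toLinearMap ∘ₗ ∑ i : Fin n, Polynomial.monomial (i : ℕ) ∘ₗ LinearMap.proj i

/-- The words of length `n` whose class in `F[x] / (x ^ n - 1)` lies in the ideal generated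
by `g`. -/
noncomputable def idealCode (n : ℕ) (g : F[X]) : Submodule F (Fin n → F) :=
  ((Ideal.span {toCyclicRing n g}).restrictScalars F).comap (wordClass n)

/-- The code of length `n` defined by the sequence `s`. -/
noncomputable def seqCode (n : ℕ) (s : ℕ → F) : Submodule F (Fin n → F) :=
  idealCode n (seqGenPoly n s)

/-- A linear code is cyclic if it contains `(c_{n-1}, c_0, …, c_{n-2})` whenever it contains
`(c_0, c_1, …, c_{n-1})`. -/
def IsCyclicCode {n : ℕ} (D : Submodule F (Fin n → F)) : Prop :=
  ∀ c ∈ D, (fun i => c ((finRotate n).symm i)) ∈ D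

/-- `g` is the generator polynomial of `D`: the monic divisor of `x ^ n - 1` that generates the
ideal of `F[x] / (x ^ n - 1)` corresponding to `D`. -/
def IsGeneratorPoly {n : ℕ} (D : Submodule F (Fin n → F)) (g : F[X]) : Prop :=
  g.Monic ∧ g ∣ X ^ n - 1 ∧ D = idealCode n g

open Classical in
/-- `d` is the minimum Hamming weight of the nonzero words of `D`. -/
def IsMinDist {n : ℕ} (D : Submodule F (Fin n → F)) (d : ℕ) : Prop :=
  IsLeast {w : ℕ | ∃ c ∈ D, c ≠ 0 ∧ hammingNorm c = w} d

/-- `D` is a linear `[n, k, d]` code. -/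
def HasParams {n : ℕ} (D : Submodule F (Fin n → F)) (k d : ℕ) : Prop :=
  Module.finrank F D = k ∧ IsMinDist D d

end Codes

/-! Write `Q = q ^ κ` and `γ = α⁻¹`. Additivity of `y ↦ y ^ Q` and Frobenius invariance of the trace
give `s_i = Tr(α ^ ((Q+1)i)) + 2 Tr(α ^ i) + m`. At an `n`-th root of unity `x`, each trace expands
into geometric sums, equal to `-1` or `0` because `n = -1` in `K`. Hence `S(x) ≠ 0` exactly when `x`
is a conjugate of `γ` or of `γ ^ (Q+1)`, or `x = 1` and `p ∤ m` (`aeval_seqPoly_ne_zero_iff`). These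
sets are disjoint, and both Frobenius orbits have full size `m`. Since `x ^ n - 1` is separable and
splits over `K`, the roots determine the generator (`seqGenPoly_eq`), and its degree gives the
dimension.

A word `c` lies in the code iff `∑ c_i γ^i = 0`, `∑ c_i γ^(i(Q+1)) = 0` and, when `p ∤ m`, `∑ c_i =
0` (`mem_idealCode_demOstromGen_iff`).

Lower bounds: in a relation of weight two the columns `γ^i` are proportional over `F`, and the
second check forces the ratio to be `1`. For `q = 3` the coefficients are `±1`, and a relation of
weight three would give either two equal columns or `(u/v)^Q = -u/v` with `u/v ≠ 0`, impossible for
odd `m`.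

Upper bounds: for `q > 3`, the positions where `γ^i ∈ F` have columns in a space of dimension two or
three, so three or four of them are dependent. For `q = 3`, two words of weight two share a syndrome
by counting; the extra check costs one more position. -/

/-! ### Ideals of `F[x] / (x ^ n - 1)` as codes. -/

section CyclicCodes

variable {F : Type*} [Field F]

/-- The polynomial `c_0 + c_1 x + ⋯ + c_{n-1} x ^ (n - 1)`. -/
noncomputable def wordPoly (n : ℕ) : (Fin n → F) →ₗ[F] F[X] :=
  ∑ i : Fin n, Polynomial.monomial (i : ℕ) ∘ₗ LinearMap.proj i

theorem wordPoly_apply {n : ℕ} (c : Fin n → F) :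
    wordPoly n c = ∑ i : Fin n, monomial (i : ℕ) (c i) := by
  simp [wordPoly]

theorem aeval_wordPoly {K : Type*} [Field K] [Algebra F K] {n : ℕ} (c : Fin n → F) (β : K) :
    aeval β (wordPoly n c) = ∑ i : Fin n, c i • β ^ (i : ℕ) := by
  simp [wordPoly_apply, aeval_monomial, Algebra.smul_def]

theorem wordClass_apply {n : ℕ} (c : Fin n → F) :
    wordClass n c = toCyclicRing n (wordPoly n c) := rfl

theorem toCyclicRing_eq_iff {n : ℕ} (a b : F[X]) :
    toCyclicRing n a = toCyclicRing n b ↔ (X ^ n - 1 : F[X]) ∣ a - b := by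
  rw [← Ideal.mem_span_singleton]
  exact Ideal.Quotient.eq

theorem mem_idealCode_iff {n : ℕ} {g : F[X]} (hg : g ∣ X ^ n - 1) (c : Fin n → F) :
    c ∈ idealCode n g ↔ g ∣ wordPoly n c := by
  have h : c ∈ idealCode n g ↔ toCyclicRing n g ∣ toCyclicRing n (wordPoly n c) := by
    rw [← Ideal.mem_span_singleton, ← wordClass_apply]
    rfl
  rw [h]
  constructor
  · rintro ⟨r, hr⟩
    obtain ⟨b, rfl⟩ := Ideal.Quotient.mkₐ_surjective F _ r
    change _ = _ * toCyclicRing n b at hr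
    rw [← map_mul, toCyclicRing_eq_iff] at hr
    exact (dvd_sub_left (dvd_mul_right g b)).mp (hg.trans hr)
  · exact map_dvd _

theorem wordPoly_surj {n : ℕ} {f : F[X]} (hf : f.degree < n) : ∃ c, wordPoly n c = f := by
  refine ⟨fun i => f.coeff i, ?_⟩
  rw [wordPoly_apply, Fin.sum_univ_eq_sum_range (fun i => monomial i (f.coeff i))]
  rcases eq_or_ne f 0 with rfl | h0
  · simp
  · exact (f.as_sum_range' n ((natDegree_lt_iff_degree_lt h0).mpr hf)).symm

/-- The code is the kernel of the map from words to `F[X] / (g)`, which is onto because remainders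
modulo `g` have degree below `n`. -/
theorem finrank_idealCode {n : ℕ} (hn : 0 < n) {g : F[X]} (hg : g ∣ X ^ n - 1) :
    Module.finrank F (idealCode n g) + g.natDegree = n := by
  have hXn : (X ^ n - 1 : F[X]) ≠ 0 := X_pow_sub_C_ne_zero hn 1
  have hg0 : g ≠ 0 := ne_zero_of_dvd_ne_zero hXn hg
  have hdeg : g.degree ≤ n := by
    have := degree_le_of_dvd hg hXn
    rwa [← C_1, degree_X_pow_sub_C hn] at this
  let φ : (Fin n → F) →ₗ[F] (F[X] ⧸ Ideal.span {g}) :=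
    (Ideal.Quotient.mkₐ F (Ideal.span {g})).toLinearMap ∘ₗ wordPoly n
  have hker : LinearMap.ker φ = idealCode n g := by
    ext c
    rw [mem_idealCode_iff hg, LinearMap.mem_ker, ← Ideal.mem_span_singleton]
    exact Ideal.Quotient.eq_zero_iff_mem
  have hsurj : Function.Surjective φ := by
    intro y
    obtain ⟨f, rfl⟩ := Ideal.Quotient.mkₐ_surjective F _ y
    obtain ⟨c, hc⟩ := wordPoly_surj (n := n) ((EuclideanDomain.mod_lt f hg0).trans_le hdeg)
    refine ⟨c, ?_⟩
    change Ideal.Quotient.mk _ (wordPoly n c) = Ideal.Quotient.mk _ f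
    rw [hc, Ideal.Quotient.eq, Ideal.mem_span_singleton]
    refine ⟨-(f / g), ?_⟩
    linear_combination EuclideanDomain.div_add_mod f g
  have h := φ.finrank_range_add_finrank_ker
  rw [LinearMap.range_eq_top.mpr hsurj, finrank_top, finrank_quotient_span_eq_natDegree, hker,
    Module.finrank_fin_fun] at h
  omega

theorem isCyclicCode_idealCode {n : ℕ} {g : F[X]} (hg : g ∣ X ^ n - 1) :
    IsCyclicCode (idealCode n g) := by
  intro c hc
  rw [mem_idealCode_iff hg] at hc ⊢
  have h : (X ^ n - 1 : F[X]) ∣ wordPoly n (fun i => c ((finRotate n).symm i)) -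
      X * wordPoly n c := by
    simp only [wordPoly_apply]
    rw [← Equiv.sum_comp (finRotate n), Finset.mul_sum, ← Finset.sum_sub_distrib]
    refine Finset.dvd_sum fun i _ => ?_
    rcases n with _ | n
    · exact i.elim0
    rw [Equiv.symm_apply_apply, X_mul_monomial, coe_finRotate]
    -- Only the last coordinate wraps around, contributing `-c_{n-1} (X ^ n - 1)`.
    split_ifs with h
    · subst h
      refine ⟨-C (c (Fin.last n)), ?_⟩
      simp only [← C_mul_X_pow_eq_monomial, Fin.val_last]
      ring
    · simp
  exact (dvd_sub_left (hc.mul_left X)).mp (hg.trans h)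

end CyclicCodes

/-! ### Words of small weight from linear dependence and from counting. -/

section LowWeight

open Classical in
theorem exists_word_of_not_linearIndependent {F V ι κ : Type*} [Field F] [DecidableEq F] [AddCommGroup V]
    [Module F V] [Fintype ι] [Fintype κ] (e : κ ↪ ι) (v : ι → V)
    (h : ¬ LinearIndependent F (v ∘ e)) :
    ∃ c : ι → F, c ≠ 0 ∧ hammingNorm c ≤ Fintype.card κ ∧ ∑ i, c i • v i = 0 := by
  obtain ⟨g, hg, k, hk⟩ := Fintype.not_linearIndependent_iff.mp h
  refine ⟨Function.extend e g 0, fun h0 => hk ?_, ?_, ?_⟩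
  · rw [← e.injective.extend_apply g 0 k, h0, Pi.zero_apply]
  · refine (Finset.card_le_card (t := Finset.univ.map e) fun i hi => ?_).trans
      (Finset.card_map e).le
    by_contra hne
    refine (Finset.mem_filter.mp hi).2 (Function.extend_apply' _ _ _ fun ⟨k, hk⟩ => hne ?_)
    exact hk ▸ Finset.mem_map_of_mem e (Finset.mem_univ k)
  · rw [← Finset.sum_subset (Finset.subset_univ (Finset.univ.map e)) fun i _ hne => ?_]
    · simpa [e.injective.extend_apply] using hg
    · rw [Function.extend_apply', Pi.zero_apply, zero_smul]
      rintro ⟨k, rfl⟩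
      exact hne (Finset.mem_map_of_mem e (Finset.mem_univ k))

theorem single_add_single_injective {F : Type*} [Field F] {N : ℕ} {i j i' j' : Fin N}
    {a b a' b' : Fˣ} (hij : i < j) (hij' : i' < j')
    (h : Pi.single i (a : F) + Pi.single j (b : F) =
      (Pi.single i' (a' : F) + Pi.single j' (b' : F) : Fin N → F)) :
    i = i' ∧ j = j' ∧ a = a' ∧ b = b' := by
  have h1 := congrFun h i
  have h2 := congrFun h j
  have h3 := congrFun h i'
  have h4 := congrFun h j'
  have ha := a.ne_zero
  have hb := b.ne_zero
  have ha' := a'.ne_zero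
  have hb' := b'.ne_zero
  simp only [Pi.add_apply, Pi.single_apply] at h1 h2 h3 h4
  simp only [Units.ext_iff]
  grind

theorem hammingNorm_add_le {F ι : Type*} [Field F] [DecidableEq F] [Fintype ι] (x y : ι → F) :
    hammingNorm (x + y) ≤ hammingNorm x + hammingNorm y := by
  have := hammingDist_triangle (x + y) y 0
  rwa [hammingDist_zero_right, hammingDist_zero_right, hammingDist_comm,
    hammingDist_eq_hammingNorm, neg_add_eq_sub, add_sub_cancel_right] at this

theorem hammingNorm_single_le {F ι : Type*} [Field F] [DecidableEq F] [Fintype ι] [DecidableEq ι] (i : ι) (a : F) :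
    hammingNorm (Pi.single i a : ι → F) ≤ 1 := by
  refine Finset.card_le_one.mpr fun x hx y hy => ?_
  have h : ∀ z, (Pi.single i a : ι → F) z ≠ 0 → z = i := fun z hz => by
    by_contra hne
    simp [hne] at hz
  rw [h x (by simpa using hx), h y (by simpa using hy)]

/-- Two words of weight two with the same syndrome differ by a word of weight at most four. -/
theorem exists_word_hammingNorm_le_four {F V : Type*} [Field F] [DecidableEq F] [AddCommGroup V] [Module F V]
    [Finite F] [Finite V] {N : ℕ} (v : Fin N → V)
    (h : 2 * Nat.card V < N * (N - 1) * (Nat.card F - 1) ^ 2) :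
    ∃ c : Fin N → F, c ≠ 0 ∧ hammingNorm c ≤ 4 ∧ ∑ i, c i • v i = 0 := by
  have := Fintype.ofFinite F
  have := Fintype.ofFinite V
  let w : ((_ : Fin N) × Fin N) × Fˣ × Fˣ → Fin N → F := fun t =>
    Pi.single t.1.2 (t.2.1 : F) + Pi.single t.1.1 (t.2.2 : F)
  let T : Finset (((_ : Fin N) × Fin N) × Fˣ × Fˣ) :=
    (Finset.univ.sigma fun j => Finset.Iio j) ×ˢ Finset.univ
  -- There are `N(N-1)/2` supports, each with `(q-1)^2` choices of nonzero coefficients.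
  have hT : T.card * 2 = N * (N - 1) * (Nat.card F - 1) ^ 2 := by
    rw [Finset.card_product, Finset.card_sigma, Finset.card_univ, Fintype.card_prod,
      Fintype.card_units, ← Nat.card_eq_fintype_card, ← Finset.sum_range_id_mul_two]
    simp only [Fin.card_Iio]
    rw [Fin.sum_univ_eq_sum_range (fun i => i)]
    ring
  have hV : (Finset.univ : Finset V).card < T.card := by
    rw [Finset.card_univ, ← Nat.card_eq_fintype_card]
    omega
  obtain ⟨s, hs, t, ht, hst, heq⟩ := Finset.exists_ne_map_eq_of_card_lt_of_maps_to hV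
    (f := fun t => ∑ i, w t i • v i) (fun _ _ => Finset.mem_coe.mpr (Finset.mem_univ _))
  have hw : ∀ t, hammingNorm (w t) ≤ 2 := fun t =>
    (hammingNorm_add_le _ _).trans
      (Nat.add_le_add (hammingNorm_single_le _ _) (hammingNorm_single_le _ _))
  refine ⟨w s - w t, fun h0 => hst ?_, ?_, ?_⟩
  · obtain ⟨⟨j, i⟩, a, b⟩ := s
    obtain ⟨⟨j', i'⟩, a', b'⟩ := t
    have hij : i < j := by simpa [T] using hs
    have hij' : i' < j' := by simpa [T] using ht
    obtain ⟨rfl, rfl, rfl, rfl⟩ := single_add_single_injective hij hij' (sub_eq_zero.mp h0)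
    rfl
  · rw [sub_eq_neg_add, ← hammingDist_eq_hammingNorm]
    have := hammingDist_triangle (w t) 0 (w s)
    rw [hammingDist_zero_right, hammingDist_zero_left] at this
    have := hw s
    have := hw t
    omega
  · simp only [Pi.sub_apply, sub_smul, Finset.sum_sub_distrib]
    exact sub_eq_zero.mpr heq

/-- Subtracting the column `v 0` from all others absorbs the condition `∑ c_i = 0`: the coefficient
at position `0` is then forced, and adds at most one to the weight. -/
theorem exists_word_hammingNorm_le_five {F V : Type*} [Field F] [DecidableEq F] [AddCommGroup V] [Module F V]
    [Finite F] [Finite V] {N : ℕ} (v : Fin (N + 1) → V)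
    (h : 2 * Nat.card V < N * (N - 1) * (Nat.card F - 1) ^ 2) :
    ∃ c : Fin (N + 1) → F, c ≠ 0 ∧ hammingNorm c ≤ 5 ∧ ∑ i, c i • v i = 0 ∧ ∑ i, c i = 0 := by
  obtain ⟨c, hc0, hc, hsum⟩ := exists_word_hammingNorm_le_four (fun i : Fin N => v i.succ - v 0) h
  have heq : (Fin.cons (-∑ i, c i) c : Fin (N + 1) → F) =
      Fin.cons 0 c + Pi.single 0 (-∑ i, c i) := by
    funext i
    refine Fin.cases ?_ (fun i => ?_) i <;> simp
  have hcons : hammingNorm (Fin.cons 0 c : Fin (N + 1) → F) = hammingNorm c := by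
    simp [hammingNorm, Finset.card_filter, Fin.sum_univ_succ]
  refine ⟨Fin.cons (-∑ i, c i) c, fun h0 => hc0 ?_, ?_, ?_, ?_⟩
  · funext i
    simpa using congrFun h0 i.succ
  · have := hammingNorm_add_le (Fin.cons 0 c : Fin (N + 1) → F) (Pi.single 0 (-∑ i, c i))
    have := hammingNorm_single_le (0 : Fin (N + 1)) (-∑ i, c i)
    rw [heq]
    omega
  · simp only [smul_sub, Finset.sum_sub_distrib, ← Finset.sum_smul] at hsum
    rw [Fin.sum_univ_succ]
    simp only [Fin.cons_zero, Fin.cons_succ, neg_smul]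
    rw [← hsum]
    abel
  · simp [Fin.sum_univ_succ]

end LowWeight

/-! ### Consequences of `m` being odd. -/

section Frobenius

/-- Under `x ↦ x ^ q` the point `z` has periods `2κ` and `m`, hence their gcd, which is odd and so
divides `κ`. -/
theorem pow_pow_eq_self_of_odd {M : Type*} [Monoid M] {z : M} {q m κ : ℕ} (hm : Odd m)
    (h1 : z ^ q ^ m = z) (h2 : z ^ q ^ (2 * κ) = z) : z ^ q ^ κ = z := by
  have key : ∀ k, Function.IsPeriodicPt (fun x : M => x ^ q) k z ↔ z ^ q ^ k = z := fun k => by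
    rw [Function.IsPeriodicPt, Function.IsFixedPt, pow_iterate]
  rw [← key] at h1 h2 ⊢
  refine (h2.gcd h1).trans_dvd ?_
  have hcop : Nat.Coprime (Nat.gcd (2 * κ) m) 2 :=
    (Nat.coprime_two_right.mpr hm).coprime_dvd_left (Nat.gcd_dvd_right _ _)
  exact hcop.dvd_of_dvd_mul_left (Nat.gcd_dvd_left _ _)

variable {K : Type*} [Field K] {q m κ : ℕ}

theorem eq_one_or_eq_neg_one_of_pow_eq_one (hm : Odd m) {z : K} (hz : z ^ q ^ m = z)
    (h : z ^ (q ^ κ + 1) = 1) : z = 1 ∨ z = -1 := by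
  have h1 : z ^ q ^ κ = z⁻¹ := eq_inv_of_mul_eq_one_left (by rw [← pow_succ, h])
  have h2 : z ^ q ^ κ = z := by
    refine pow_pow_eq_self_of_odd hm hz ?_
    rw [two_mul, pow_add, pow_mul, h1, inv_pow, h1, inv_inv]
  rw [pow_succ, h2] at h
  exact mul_self_eq_one_iff.mp h

theorem eq_zero_of_pow_eq_neg (hm : Odd m) (hq : Odd q) (h2 : (2 : K) ≠ 0) {z : K}
    (hz : z ^ q ^ m = z) (h : z ^ q ^ κ = -z) : z = 0 := by
  have h3 : z ^ q ^ κ = z := by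
    refine pow_pow_eq_self_of_odd hm hz ?_
    rw [two_mul, pow_add, pow_mul, h, (hq.pow).neg_pow, h, neg_neg]
  have : 2 * z = 0 := by linear_combination h - h3
  exact (mul_eq_zero.mp this).resolve_left h2

end Frobenius

/-! ### Frobenius orbits and minimal polynomials. -/

section Minpoly

variable {F K : Type*} [Field F] [Field K] [Finite F] [Finite K] [Algebra F K]

-- If the degree `d` were below `[K : F]`, then `β` would lie in a subfield with `q ^ d` elements
-- and be fixed by the `d`-th Frobenius power.
omit [Finite F] in
theorem natDegree_minpoly_of_pow_ne {β : K}
    (h : ∀ t < Module.finrank F K, β ^ Nat.card F ^ t = β → t = 0) :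
    (minpoly F β).natDegree = Module.finrank F K := by
  have hint : IsIntegral F β := Algebra.IsIntegral.isIntegral β
  refine le_antisymm (minpoly.natDegree_le β) (le_of_not_gt fun hlt => ?_)
  refine (minpoly.natDegree_pos hint).ne' (h _ hlt ?_)
  have hcard := Module.natCard_eq_pow_finrank (K := F) (V := IntermediateField.adjoin F {β})
  rw [IntermediateField.adjoin.finrank hint] at hcard
  have hmem := IntermediateField.mem_adjoin_simple_self F β
  have := Fintype.ofFinite (IntermediateField.adjoin F {β})
  have hfix := FiniteField.pow_card (⟨β, hmem⟩ : IntermediateField.adjoin F {β})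
  rw [← Nat.card_eq_fintype_card, hcard] at hfix
  exact congrArg Subtype.val hfix

/-- The roots are the Galois conjugates, and the Galois group consists of powers of Frobenius. -/
theorem aeval_minpoly_eq_zero_iff (β x : K) :
    aeval x (minpoly F β) = 0 ↔ ∃ t < Module.finrank F K, x = β ^ Nat.card F ^ t := by
  have := Fintype.ofFinite F
  rw [← isConjRoot_iff_aeval_eq_zero (Algebra.IsIntegral.isIntegral β), IsConjRoot.comm,
    isConjRoot_iff_exists_algEquiv]
  have key : ∀ t : ℕ, (FiniteField.frobeniusAlgEquivOfAlgebraic F K ^ t) β =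
      β ^ Nat.card F ^ t := fun t => by
    rw [AlgEquiv.coe_pow, FiniteField.coe_frobeniusAlgEquivOfAlgebraic_iterate,
      Nat.card_eq_fintype_card]
  constructor
  · rintro ⟨σ, rfl⟩
    obtain ⟨t, rfl⟩ := (FiniteField.bijective_frobeniusAlgEquivOfAlgebraic_pow F K).2 σ
    exact ⟨t, t.2, key t⟩
  · rintro ⟨t, -, rfl⟩
    exact ⟨_, key t⟩

theorem trace_pow_card_pow (y : K) (κ : ℕ) :
    Algebra.trace F K (y ^ Nat.card F ^ κ) = Algebra.trace F K y := by
  have := Fintype.ofFinite F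
  rw [← Algebra.trace_eq_of_algEquiv (FiniteField.frobeniusAlgEquivOfAlgebraic F K ^ κ) y,
    AlgEquiv.coe_pow, FiniteField.coe_frobeniusAlgEquivOfAlgebraic_iterate,
    Nat.card_eq_fintype_card]

theorem pow_card_pow_injOn {β : K} (h : ∀ t < Module.finrank F K, β ^ Nat.card F ^ t = β → t = 0) :
    Set.InjOn (fun t => β ^ Nat.card F ^ t) (Set.Iio (Module.finrank F K)) := by
  have key : ∀ s t, s ≤ t → t < Module.finrank F K → β ^ Nat.card F ^ s = β ^ Nat.card F ^ t →
      s = t := by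
    intro s t hst ht heq
    have := Fintype.ofFinite F
    have hinj := (FiniteField.frobeniusAlgEquivOfAlgebraic F K ^ s).injective
    rw [AlgEquiv.coe_pow, FiniteField.coe_frobeniusAlgEquivOfAlgebraic_iterate,
      ← Nat.card_eq_fintype_card] at hinj
    have := h (t - s) (by omega) (hinj (by
      change (β ^ Nat.card F ^ (t - s)) ^ Nat.card F ^ s = β ^ Nat.card F ^ s
      rw [← pow_mul, ← pow_add, Nat.sub_add_cancel hst, heq]))
    omega
  intro s hs t ht heq
  rcases le_total s t with hst | hst
  · exact key s t hst ht heq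
  · exact (key t s hst hs heq.symm).symm

open Classical in
theorem sum_ite_pow_mul_eq_one {β : K}
    (h : ∀ t < Module.finrank F K, β ^ Nat.card F ^ t = β → t = 0) (x : K) (c : K) :
    ∑ t ∈ Finset.range (Module.finrank F K), (if β ^ Nat.card F ^ t * x = 1 then c else 0) =
      if ∃ t < Module.finrank F K, β ^ Nat.card F ^ t * x = 1 then c else 0 := by
  split_ifs with hex
  · obtain ⟨t, ht, hx⟩ := hex
    rw [Finset.sum_eq_single_of_mem t (Finset.mem_range.mpr ht), if_pos hx]
    intro s hs hst
    refine if_neg fun hs1 => hst (pow_card_pow_injOn h (Finset.mem_range.mp hs) ht ?_)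
    exact mul_right_cancel₀ (right_ne_zero_of_mul_eq_one hx) (hs1.trans hx.symm)
  · exact Finset.sum_eq_zero fun t ht => if_neg fun h1 => hex ⟨t, Finset.mem_range.mp ht, h1⟩

end Minpoly

/-! ### Comparing divisors of a separable split polynomial by their roots. -/

section GeneratorPolynomial

theorem dvd_of_forall_aeval_eq_zero {F K : Type*} [Field F] [Field K] [Algebra F K] {P g h : F[X]}
    (hP : P.Separable) (hs : (P.map (algebraMap F K)).Splits) (hg : g ∣ P) (hh : h ≠ 0)
    (H : ∀ x : K, aeval x g = 0 → aeval x h = 0) : g ∣ h := by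
  have hP0 : P.map (algebraMap F K) ≠ 0 := map_ne_zero hP.ne_zero
  have hg' : g.map (algebraMap F K) ∣ P.map (algebraMap F K) := Polynomial.map_dvd _ hg
  have hg0 : g.map (algebraMap F K) ≠ 0 := ne_zero_of_dvd_ne_zero hP0 hg'
  rw [← map_dvd_map' (algebraMap F K)]
  refine (hs.of_dvd hP0 hg').dvd_of_roots_le_roots hg0 ?_
  rw [Multiset.le_iff_subset (nodup_roots (hP.map.of_dvd hg'))]
  intro x hx
  rw [mem_roots hg0, IsRoot, eval_map_algebraMap] at hx
  rw [mem_roots (map_ne_zero hh), IsRoot, eval_map_algebraMap]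
  exact H x hx

/-- Separability makes the gcd and its cofactor coprime, so each root of `P` is a root of exactly
one of them. -/
theorem aeval_div_gcd_eq_zero_iff {F K : Type*} [Field F] [DecidableEq F] [Field K] [Algebra F K]
    {P S : F[X]} (hP : P.Separable) {x : K} (hx : aeval x P = 0) :
    aeval x (P / EuclideanDomain.gcd S P) = 0 ↔ aeval x S ≠ 0 := by
  have hmul : EuclideanDomain.gcd S P * (P / EuclideanDomain.gcd S P) = P :=
    EuclideanDomain.mul_div_cancel' (fun h0 => hP.ne_zero (EuclideanDomain.gcd_eq_zero_iff.mp h0).2)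
      (EuclideanDomain.gcd_dvd_right S P)
  have hgcd : aeval x (EuclideanDomain.gcd S P) = 0 ↔ aeval x S = 0 := by
    constructor
    · intro h
      exact aeval_eq_zero_of_dvd_aeval_eq_zero (EuclideanDomain.gcd_dvd_left S P) h
    · intro h
      rw [EuclideanDomain.gcd_eq_gcd_ab, map_add, map_mul, map_mul, h, hx, zero_mul, zero_mul,
        add_zero]
  rw [← not_iff_not, not_ne_iff, ← hgcd]
  constructor
  · intro h
    rw [← hmul, map_mul] at hx
    exact (mul_eq_zero.mp hx).resolve_right h
  · intro h h'
    rw [← hmul] at hP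
    obtain ⟨a, b, hab⟩ := hP.isCoprime
    have := congrArg (aeval x) hab
    rw [map_add, map_mul, map_mul, h, h', mul_zero, mul_zero, add_zero, map_one] at this
    exact zero_ne_one this

end GeneratorPolynomial

/-! ### Orbits of `α`, `α ^ (Q+1)` and `1`: full size and disjointness. -/

section PrimitiveElement

variable {F K : Type*} [Field F] [Field K] [Finite K] [Algebra F K] {n κ : ℕ} {α : K}

theorem pow_card_pow_finrank (x : K) : x ^ Nat.card F ^ Module.finrank F K = x := by
  have := Fintype.ofFinite K
  rw [← Module.natCard_eq_pow_finrank, Nat.card_eq_fintype_card, FiniteField.pow_card]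

-- Here `n ∣ 2(q^t - 1)`, while `n ≥ q^(t+1) - 1 ≥ 3 q^t - 1` is larger. Working with squares covers
-- both `α` and `α ^ (Q+1)`, since for the latter `α^(q^t) = ±α`.
omit [Finite K] in
theorem frobenius_fixed_of_sq (hq : 3 ≤ Nat.card F) (hn : n + 1 = Nat.card F ^ Module.finrank F K)
    (hα : IsPrimitiveRoot α n) (hα0 : α ≠ 0) {t : ℕ} (ht : t < Module.finrank F K)
    (h : (α ^ Nat.card F ^ t) ^ 2 = α ^ 2) : t = 0 := by
  have hpos : 0 < Nat.card F ^ t := by positivity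
  have h1 : α ^ (2 * (Nat.card F ^ t - 1)) = 1 := by
    refine mul_left_cancel₀ (pow_ne_zero 2 hα0) ?_
    rw [← pow_add, mul_one, ← h, ← pow_mul]
    congr 1
    omega
  have h2 := hα.dvd_of_pow_eq_one _ h1
  have h3 : Nat.card F ^ (t + 1) ≤ n + 1 := hn ▸ Nat.pow_le_pow_right (by omega) ht
  rw [pow_succ] at h3
  have h4 : Nat.card F ^ t * 3 ≤ Nat.card F ^ t * Nat.card F := Nat.mul_le_mul_left _ hq
  by_contra h0
  have h5 : 1 < Nat.card F ^ t := Nat.one_lt_pow h0 (by omega)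
  have := Nat.le_of_dvd (by omega) h2
  omega

omit [Finite K] in
theorem frobenius_pow_ne_self (hq : 3 ≤ Nat.card F)
    (hn : n + 1 = Nat.card F ^ Module.finrank F K)
    (hα : IsPrimitiveRoot α n) (hα0 : α ≠ 0) :
    ∀ t < Module.finrank F K, α ^ Nat.card F ^ t = α → t = 0 := fun _ ht h =>
  frobenius_fixed_of_sq hq hn hα hα0 ht (by rw [h])

theorem frobenius_pow_ne_self_of_pow (hq : 3 ≤ Nat.card F) (hm : Odd (Module.finrank F K))
    (hn : n + 1 = Nat.card F ^ Module.finrank F K)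
    (hα : IsPrimitiveRoot α n) (hα0 : α ≠ 0) :
    ∀ t < Module.finrank F K,
      (α ^ (Nat.card F ^ κ + 1)) ^ Nat.card F ^ t = α ^ (Nat.card F ^ κ + 1) → t = 0 := by
  intro t ht h
  refine frobenius_fixed_of_sq hq hn hα hα0 ht ?_
  have h1 : (α ^ Nat.card F ^ t / α) ^ (Nat.card F ^ κ + 1) = 1 := by
    rw [div_pow, pow_right_comm, h, div_self (pow_ne_zero _ hα0)]
  rcases eq_one_or_eq_neg_one_of_pow_eq_one hm (pow_card_pow_finrank (F := F) _) h1 with h2 | h2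
  · rw [div_eq_one_iff_eq hα0] at h2
    rw [h2]
  · rw [div_eq_iff hα0] at h2
    rw [h2]
    ring

omit [Finite K] in
theorem pow_half_eq_neg_one {h : ℕ} (hh : 0 < h) (hα : IsPrimitiveRoot α (2 * h)) :
    α ^ h = -1 := by
  have h1 : α ^ h * α ^ h = 1 := by rw [← pow_add, ← two_mul, hα.pow_eq_one]
  refine (mul_self_eq_one_iff.mp h1).resolve_left fun h2 => ?_
  have := Nat.le_of_dvd hh (hα.dvd_of_pow_eq_one _ h2)
  omega

omit [Finite K] in
theorem exists_half (hq : Odd (Nat.card F)) (hn : n + 1 = Nat.card F ^ Module.finrank F K) :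
    ∃ h, n = 2 * h := by
  obtain ⟨h, hh⟩ := hq.pow (n := Module.finrank F K)
  exact ⟨h, by omega⟩

-- The power `n/2` sends `α` to `-1`. Since `Q+1` is even and `q^t` is odd, it separates the two
-- orbits.
omit [Finite K] in
theorem frobenius_pow_ne_frobenius_pow (h2 : (2 : K) ≠ 0) (hq : Odd (Nat.card F)) (hn0 : 0 < n)
    (hn : n + 1 = Nat.card F ^ Module.finrank F K) (hα : IsPrimitiveRoot α n) (s t : ℕ) :
    (α ^ (Nat.card F ^ κ + 1)) ^ Nat.card F ^ s ≠ α ^ Nat.card F ^ t := by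
  obtain ⟨h, rfl⟩ := exists_half hq hn
  have hα1 := pow_half_eq_neg_one (by omega) hα
  intro heq
  have h3 := congrArg (· ^ h) heq
  simp only [pow_right_comm _ _ h, hα1] at h3
  rw [(hq.pow.add_odd odd_one).neg_one_pow, one_pow, hq.pow.neg_one_pow] at h3
  exact h2 (by linear_combination h3)

omit [Finite K] in
theorem frobenius_pow_ne_one (h2 : (2 : K) ≠ 0) (hq : Odd (Nat.card F)) (hn0 : 0 < n)
    (hn : n + 1 = Nat.card F ^ Module.finrank F K) (hα : IsPrimitiveRoot α n) (t : ℕ) :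
    α ^ Nat.card F ^ t ≠ 1 := by
  obtain ⟨h, rfl⟩ := exists_half hq hn
  have hα1 := pow_half_eq_neg_one (by omega) hα
  intro heq
  have h3 := congrArg (· ^ h) heq
  simp only [pow_right_comm _ _ h, hα1] at h3
  rw [one_pow, hq.pow.neg_one_pow] at h3
  exact h2 (by linear_combination -h3)

theorem frobenius_pow_pow_ne_one (hm : Odd (Module.finrank F K)) (hn2 : 2 < n)
    (hα : IsPrimitiveRoot α n) {t : ℕ} (ht : t < Module.finrank F K) :
    (α ^ (Nat.card F ^ κ + 1)) ^ Nat.card F ^ t ≠ 1 := by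
  intro h
  have h1 : α ^ (Nat.card F ^ κ + 1) = 1 := by
    rw [← pow_card_pow_finrank (F := F) (α ^ (Nat.card F ^ κ + 1)),
      ← Nat.add_sub_cancel' ht.le, pow_add (Nat.card F), pow_mul _ (Nat.card F ^ t), h, one_pow]
  have h2 : α ^ 2 = 1 := by
    rcases eq_one_or_eq_neg_one_of_pow_eq_one hm (pow_card_pow_finrank (F := F) α) h1 with h | h <;>
      simp [h]
  have := Nat.le_of_dvd two_pos (hα.dvd_of_pow_eq_one _ h2)
  omega

end PrimitiveElement

/-! ### Values of `S` at the `n`-th roots of unity. -/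

section SequencePolynomial

variable {F K : Type*} [Field F] [Field K] [Finite F] [Finite K] [Algebra F K] {n κ : ℕ} {α : K}

theorem demOstrom_add_one (y : K) :
    demOstrom K (Nat.card F) κ (y + 1) = y ^ (Nat.card F ^ κ + 1) + y ^ Nat.card F ^ κ + y + 1 := by
  have := Fintype.ofFinite F
  have hfr : (y + 1) ^ Nat.card F ^ κ = y ^ Nat.card F ^ κ + 1 := by
    have h := map_add (FiniteField.frobeniusAlgEquivOfAlgebraic F K ^ κ) y 1
    rw [AlgEquiv.coe_pow, FiniteField.coe_frobeniusAlgEquivOfAlgebraic_iterate,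
      ← Nat.card_eq_fintype_card] at h
    simpa using h
  rw [demOstrom, pow_succ, hfr]
  ring

theorem assocSeq_demOstrom (i : ℕ) :
    assocSeq F (demOstrom K (Nat.card F) κ) α i =
      Algebra.trace F K ((α ^ (Nat.card F ^ κ + 1)) ^ i) + 2 * Algebra.trace F K (α ^ i) +
        Module.finrank F K := by
  rw [assocSeq, demOstrom_add_one, map_add, map_add, map_add, trace_pow_card_pow,
    ← map_one (algebraMap F K), Algebra.trace_algebraMap, pow_right_comm, nsmul_one]
  ring

omit [Finite F] in
theorem natCast_eq_neg_one (hn : n + 1 = Nat.card F ^ Module.finrank F K) : (n : K) = -1 := by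
  have h := congrArg (Nat.cast : ℕ → K) hn
  rw [← Module.natCard_eq_pow_finrank] at h
  have := Fintype.ofFinite K
  rw [Nat.card_eq_fintype_card, FiniteField.cast_card_eq_zero] at h
  push_cast at h
  linear_combination h

omit [Finite F] in
theorem separable_X_pow_sub_one (hn : n + 1 = Nat.card F ^ Module.finrank F K) :
    (X ^ n - 1 : F[X]).Separable := by
  rw [X_pow_sub_one_separable_iff]
  intro h0
  have h1 := congrArg (algebraMap F K) h0
  rw [map_natCast, natCast_eq_neg_one hn, map_zero] at h1
  exact one_ne_zero (neg_eq_zero.mp h1)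

omit [Finite K] in
open Classical in
theorem geom_sum_of_pow_eq_one {z : K} (hn : (n : K) = -1) (hz : z ^ n = 1) :
    ∑ i ∈ Finset.range n, z ^ i = if z = 1 then -1 else 0 := by
  split_ifs with h
  · simp [h, hn]
  · have := mul_geom_sum z n
    rw [hz, sub_self] at this
    exact (mul_eq_zero.mp this).resolve_left (sub_ne_zero.mpr h)

-- Expanding the trace gives geometric sums in `β^(q^t) x`; as the conjugates of `β` are distinct,
-- at most one `t` contributes.
open Classical in
theorem sum_trace_mul_pow {β x : K} (hn : (n : K) = -1) (hβ : β ^ n = 1) (hx : x ^ n = 1)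
    (h : ∀ t < Module.finrank F K, β ^ Nat.card F ^ t = β → t = 0) :
    ∑ i ∈ Finset.range n, algebraMap F K (Algebra.trace F K (β ^ i)) * x ^ i =
      if ∃ t < Module.finrank F K, β ^ Nat.card F ^ t * x = 1 then -1 else 0 := by
  simp only [FiniteField.algebraMap_trace_eq_sum_pow, Finset.sum_mul]
  rw [Finset.sum_comm, ← sum_ite_pow_mul_eq_one h x (-1)]
  refine Finset.sum_congr rfl fun t _ => ?_
  rw [← geom_sum_of_pow_eq_one hn (by rw [mul_pow, pow_right_comm, hβ, one_pow, hx, one_mul])]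
  refine Finset.sum_congr rfl fun i _ => ?_
  rw [mul_pow, pow_right_comm]

theorem aeval_seqPoly_ne_zero_iff (h2 : (2 : K) ≠ 0) (hq : Odd (Nat.card F))
    (hm : Odd (Module.finrank F K)) (hn : n + 1 = Nat.card F ^ Module.finrank F K) (hn2 : 2 < n)
    (hq3 : 3 ≤ Nat.card F) (hα : IsPrimitiveRoot α n) (hα0 : α ≠ 0) {x : K} (hx : x ^ n = 1) :
    aeval x (seqPoly n (assocSeq F (demOstrom K (Nat.card F) κ) α)) ≠ 0 ↔
      ((Module.finrank F K : F) ≠ 0 ∧ x = 1) ∨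
      (∃ t < Module.finrank F K, α ^ Nat.card F ^ t * x = 1) ∨
      ∃ t < Module.finrank F K, (α ^ (Nat.card F ^ κ + 1)) ^ Nat.card F ^ t * x = 1 := by
  classical
  have hnK := natCast_eq_neg_one hn
  -- Three indicators with coefficients `-1`, `-2` and `-m`; disjointness of their supports rules
  -- out cancellation.
  have hS : aeval x (seqPoly n (assocSeq F (demOstrom K (Nat.card F) κ) α)) =
      (if ∃ t < Module.finrank F K, (α ^ (Nat.card F ^ κ + 1)) ^ Nat.card F ^ t * x = 1
        then -1 else 0) +
      2 * (if ∃ t < Module.finrank F K, α ^ Nat.card F ^ t * x = 1 then -1 else 0) +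
      algebraMap F K (Module.finrank F K) * (if x = 1 then -1 else 0) := by
    rw [← sum_trace_mul_pow hnK (by rw [pow_right_comm, hα.pow_eq_one, one_pow]) hx
        (frobenius_pow_ne_self_of_pow hq3 hm hn hα hα0),
      ← sum_trace_mul_pow hnK hα.pow_eq_one hx (frobenius_pow_ne_self hq3 hn hα hα0),
      ← geom_sum_of_pow_eq_one hnK hx, Finset.mul_sum, Finset.mul_sum, ← Finset.sum_add_distrib,
      ← Finset.sum_add_distrib, seqPoly, map_sum]
    refine Finset.sum_congr rfl fun i _ => ?_
    rw [assocSeq_demOstrom, map_mul, aeval_C, aeval_X_pow]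
    simp only [map_add, map_mul, map_ofNat]
    ring
  have h12 : (∃ t < Module.finrank F K, (α ^ (Nat.card F ^ κ + 1)) ^ Nat.card F ^ t * x = 1) →
      ¬ ∃ t < Module.finrank F K, α ^ Nat.card F ^ t * x = 1 := by
    rintro ⟨s, -, hs⟩ ⟨t, -, ht⟩
    exact frobenius_pow_ne_frobenius_pow h2 hq (by omega) hn hα s t
      (mul_right_cancel₀ (right_ne_zero_of_mul_eq_one hs) (hs.trans ht.symm))
  have h10 : (∃ t < Module.finrank F K, (α ^ (Nat.card F ^ κ + 1)) ^ Nat.card F ^ t * x = 1) →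
      x ≠ 1 := by
    rintro ⟨s, hs', hs⟩ rfl
    exact frobenius_pow_pow_ne_one hm hn2 hα hs' ((mul_one _).symm.trans hs)
  have h20 : (∃ t < Module.finrank F K, α ^ Nat.card F ^ t * x = 1) → x ≠ 1 := by
    rintro ⟨s, -, hs⟩ rfl
    exact frobenius_pow_ne_one h2 hq (by omega) hn hα s ((mul_one _).symm.trans hs)
  rw [hS]
  by_cases h1 : ∃ t < Module.finrank F K, (α ^ (Nat.card F ^ κ + 1)) ^ Nat.card F ^ t * x = 1
  · rw [if_pos h1, if_neg (h12 h1), if_neg (h10 h1)]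
    simp [h1]
  · by_cases h3 : ∃ t < Module.finrank F K, α ^ Nat.card F ^ t * x = 1
    · rw [if_neg h1, if_pos h3, if_neg (h20 h3)]
      simp [h3, h2]
    · rw [if_neg h1, if_neg h3]
      by_cases h4 : x = 1
      · simp only [h1, h3, or_false]
        rw [← (algebraMap F K).injective.ne_iff]
        simp [h4]
      · simp only [h1, h3, h4, or_false]
        simp

end SequencePolynomial

/-! ### Identification of the generator polynomial. -/

section Generator

variable {F K : Type*} [Field F] [Field K] [Finite F] [Finite K] [Algebra F K] {n κ : ℕ} {α : K}

omit [Finite F] [Finite K] in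
theorem minpoly_dvd_X_pow_sub_one {β : K} (hβ : β ^ n = 1) : minpoly F β ∣ X ^ n - 1 :=
  minpoly.dvd F β (by simp [hβ])

omit [Finite K] in
theorem mul_eq_one_iff_eq_inv_pow {β x : K} (hβ : β ≠ 0) (k : ℕ) :
    β ^ k * x = 1 ↔ x = β⁻¹ ^ k := by
  rw [inv_pow, mul_comm, mul_eq_one_iff_eq_inv₀ (pow_ne_zero k hβ)]

variable (F) in
/-- The expected generator polynomial of the code of the Dembowski–Ostrom function. -/
noncomputable def demOstromGen (ε κ : ℕ) (γ : K) : F[X] :=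
  (X - 1) ^ ε * minpoly F γ * minpoly F (γ ^ (Nat.card F ^ κ + 1))

theorem aeval_demOstromGen_eq_zero_iff (ε : ℕ) (γ x : K) :
    aeval x (demOstromGen F ε κ γ) = 0 ↔ (ε ≠ 0 ∧ x = 1) ∨
      (∃ t < Module.finrank F K, x = γ ^ Nat.card F ^ t) ∨
      ∃ t < Module.finrank F K, x = (γ ^ (Nat.card F ^ κ + 1)) ^ Nat.card F ^ t := by
  rw [demOstromGen, map_mul, map_mul, map_pow, mul_eq_zero, mul_eq_zero,
    aeval_minpoly_eq_zero_iff, aeval_minpoly_eq_zero_iff, pow_eq_zero_iff', or_assoc]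
  simp [sub_eq_zero, and_comm]

omit [Finite F] in
theorem demOstromGen_monic (ε : ℕ) (γ : K) : (demOstromGen F ε κ γ).Monic :=
  (((monic_X_sub_C (1 : F)).pow ε).mul (minpoly.monic (Algebra.IsIntegral.isIntegral γ))).mul
    (minpoly.monic (Algebra.IsIntegral.isIntegral _))

omit [Finite F] in
theorem natDegree_demOstromGen (hq3 : 3 ≤ Nat.card F) (hm : Odd (Module.finrank F K))
    (hn : n + 1 = Nat.card F ^ Module.finrank F K) (ε : ℕ) {γ : K} (hγ : IsPrimitiveRoot γ n)
    (hγ0 : γ ≠ 0) :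
    (demOstromGen F ε κ γ).natDegree = ε + 2 * Module.finrank F K := by
  have h1 := minpoly.monic (Algebra.IsIntegral.isIntegral (R := F) γ)
  have h2 := minpoly.monic (Algebra.IsIntegral.isIntegral (R := F) (γ ^ (Nat.card F ^ κ + 1)))
  have h0 := (monic_X_sub_C (1 : F)).pow ε
  rw [demOstromGen, ← C_1, (h0.mul h1).natDegree_mul h2, h0.natDegree_mul h1,
    natDegree_pow, natDegree_X_sub_C,
    natDegree_minpoly_of_pow_ne (frobenius_pow_ne_self hq3 hn hγ hγ0),
    natDegree_minpoly_of_pow_ne (frobenius_pow_ne_self_of_pow hq3 hm hn hγ hγ0)]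
  ring

theorem demOstromGen_dvd (h2 : (2 : K) ≠ 0) (hq : Odd (Nat.card F))
    (hm : Odd (Module.finrank F K)) (hn : n + 1 = Nat.card F ^ Module.finrank F K) (hn2 : 2 < n)
    {ε : ℕ} (hε : ε ≤ 1) {γ : K} (hγ : IsPrimitiveRoot γ n) :
    demOstromGen F ε κ γ ∣ X ^ n - 1 := by
  have hirr := fun β : K => minpoly.irreducible (Algebra.IsIntegral.isIntegral (R := F) β)
  have hcop : ∀ β : K, (∀ t < Module.finrank F K, β ^ Nat.card F ^ t ≠ 1) →
      IsCoprime ((X - 1 : F[X]) ^ ε) (minpoly F β) := by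
    intro β hβ
    refine IsCoprime.pow_left ?_
    rw [← C_1, ((irreducible_X_sub_C (1 : F)).coprime_iff_not_dvd)]
    intro hdvd
    have h1 : aeval (1 : K) (minpoly F β) = 0 :=
      aeval_eq_zero_of_dvd_aeval_eq_zero hdvd (by simp)
    obtain ⟨t, ht, h⟩ := (aeval_minpoly_eq_zero_iff β 1).mp h1
    exact hβ t ht h.symm
  have hcop2 : IsCoprime (minpoly F γ) (minpoly F (γ ^ (Nat.card F ^ κ + 1))) := by
    rw [(hirr _).coprime_iff_not_dvd]
    intro hdvd
    have h1 : aeval γ (minpoly F (γ ^ (Nat.card F ^ κ + 1))) = 0 :=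
      aeval_eq_zero_of_dvd_aeval_eq_zero hdvd (minpoly.aeval F γ)
    obtain ⟨t, -, h⟩ := (aeval_minpoly_eq_zero_iff _ _).mp h1
    refine frobenius_pow_ne_frobenius_pow (κ := κ) h2 hq (by omega) hn hγ t 0 ?_
    rw [← h, pow_zero, pow_one]
  have hA := hcop γ fun t _ => frobenius_pow_ne_one h2 hq (by omega) hn hγ t
  have hB := hcop (γ ^ (Nat.card F ^ κ + 1)) fun t ht => frobenius_pow_pow_ne_one hm hn2 hγ ht
  refine (hB.mul_left hcop2).mul_dvd (hA.mul_dvd ?_ (minpoly_dvd_X_pow_sub_one hγ.pow_eq_one))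
    (minpoly_dvd_X_pow_sub_one (by rw [pow_right_comm, hγ.pow_eq_one, one_pow]))
  refine (pow_dvd_pow _ hε).trans ?_
  rw [pow_one]
  exact sub_one_dvd_pow_sub_one X n

theorem seqGenPoly_eq (h2 : (2 : K) ≠ 0) (hq : Odd (Nat.card F))
    (hm : Odd (Module.finrank F K)) (hn : n + 1 = Nat.card F ^ Module.finrank F K) (hn2 : 2 < n)
    (hq3 : 3 ≤ Nat.card F) (hα : IsPrimitiveRoot α n) (hα0 : α ≠ 0)
    {ε : ℕ} (hε : ε ≤ 1) (hε0 : ε ≠ 0 ↔ (Module.finrank F K : F) ≠ 0) :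
    seqGenPoly n (assocSeq F (demOstrom K (Nat.card F) κ) α) = demOstromGen F ε κ α⁻¹ := by
  classical
  have hg := demOstromGen_dvd (κ := κ) h2 hq hm hn hn2 hε hα.inv
  set S := seqPoly n (assocSeq F (demOstrom K (Nat.card F) κ) α)
  have hP : (X ^ n - 1 : F[X]).Separable := separable_X_pow_sub_one hn
  have hs : ((X ^ n - 1 : F[X]).map (algebraMap F K)).Splits := by
    simpa using X_pow_sub_one_splits hα
  have hmul : EuclideanDomain.gcd S (X ^ n - 1) *
      ((X ^ n - 1) / EuclideanDomain.gcd S (X ^ n - 1)) = X ^ n - 1 :=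
    EuclideanDomain.mul_div_cancel' (fun h0 => hP.ne_zero (EuclideanDomain.gcd_eq_zero_iff.mp h0).2)
      (EuclideanDomain.gcd_dvd_right S _)
  have hh : (X ^ n - 1) / EuclideanDomain.gcd S (X ^ n - 1) ∣ X ^ n - 1 := Dvd.intro_left _ hmul
  have hroot : ∀ x : K, x ^ n = 1 → (aeval x ((X ^ n - 1) / EuclideanDomain.gcd S (X ^ n - 1)) = 0 ↔
      aeval x (demOstromGen F ε κ α⁻¹) = 0) := by
    intro x hx
    rw [aeval_div_gcd_eq_zero_iff hP (by simp [hx]),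
      aeval_seqPoly_ne_zero_iff h2 hq hm hn hn2 hq3 hα hα0 hx, aeval_demOstromGen_eq_zero_iff, hε0]
    simp only [mul_eq_one_iff_eq_inv_pow hα0, mul_eq_one_iff_eq_inv_pow (pow_ne_zero _ hα0),
      inv_pow]
  have hdvdroot : ∀ f : F[X], f ∣ X ^ n - 1 → ∀ x : K, aeval x f = 0 → x ^ n = 1 := by
    intro f hf x hx
    have := aeval_eq_zero_of_dvd_aeval_eq_zero hf hx
    simpa [sub_eq_zero] using this
  -- Both sides are normalized, so mutual divisibility suffices, and that is read off from the
  -- roots.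
  rw [seqGenPoly, ← (demOstromGen_monic ε α⁻¹).normalize_eq_self]
  refine normalize_eq_normalize ?_ ?_
  · convert dvd_of_forall_aeval_eq_zero hP hs hh (demOstromGen_monic ε α⁻¹).ne_zero
      fun x hx => (hroot x (hdvdroot _ hh x hx)).mp hx
  · convert dvd_of_forall_aeval_eq_zero hP hs hg (ne_zero_of_dvd_ne_zero hP.ne_zero hh)
      fun x hx => (hroot x (hdvdroot _ hg x hx)).mpr hx

end Generator

/-! ### Lower bounds for the weight. -/

section Weights

variable {F K : Type*} [Field F] [Field K] [Finite F] [Finite K] [Algebra F K] {κ : ℕ}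

theorem add_pow_card_pow (κ : ℕ) (y z : K) :
    (y + z) ^ Nat.card F ^ κ = y ^ Nat.card F ^ κ + z ^ Nat.card F ^ κ := by
  have := Fintype.ofFinite F
  have h := map_add (FiniteField.frobeniusAlgEquivOfAlgebraic F K ^ κ) y z
  rwa [AlgEquiv.coe_pow, FiniteField.coe_frobeniusAlgEquivOfAlgebraic_iterate,
    ← Nat.card_eq_fintype_card] at h

/-- Put `z = l y` with `l ∈ F`. Since `l ^ Q = l`, the second relation becomes `a + b l^2 = 0`, and
`a = -b l` leaves `l = 1`. -/
theorem eq_of_two_term_relation {a b : F} (hb : b ≠ 0) {y z : K} (hy : y ≠ 0)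
    (hz : z ≠ 0) (h1 : a • y + b • z = 0)
    (h2 : a • y ^ (Nat.card F ^ κ + 1) + b • z ^ (Nat.card F ^ κ + 1) = 0) : y = z := by
  have := Fintype.ofFinite F
  have hzy : z = (-(a / b)) • y := by
    have hbK : algebraMap F K b ≠ 0 := by simpa using hb
    simp only [Algebra.smul_def, map_neg, map_div₀] at h1 ⊢
    field_simp
    linear_combination h1
  set l := -(a / b) with hl
  have ha : a = -(b * l) := by rw [hl]; field_simp
  have hl0 : l ≠ 0 := fun h0 => hz (by rw [hzy, h0, zero_smul])
  have hlQ : l ^ (Nat.card F ^ κ + 1) = l * l := by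
    rw [pow_succ, Nat.card_eq_fintype_card, FiniteField.pow_card_pow]
  rw [hzy, _root_.smul_pow, hlQ, smul_smul, ← add_smul, ha] at h2
  have h3 := (smul_eq_zero.mp h2).resolve_right (pow_ne_zero _ hy)
  have h4 : b * l * (l - 1) = 0 := by linear_combination h3
  have h5 : l = 1 := sub_eq_zero.mp ((mul_eq_zero.mp h4).resolve_left (mul_ne_zero hb hl0))
  rw [hzy, h5, one_smul]

/-- Equality would kill the cross terms, `y^Q z + y z^Q = 0`, that is `(y/z)^Q = -y/z`. -/
theorem ne_zero_of_add_eq (h2 : (2 : K) ≠ 0) (hq : Odd (Nat.card F))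
    (hm : Odd (Module.finrank F K)) {y z : K} (hy : y ≠ 0) (hz : z ≠ 0) :
    y ^ (Nat.card F ^ κ + 1) + z ^ (Nat.card F ^ κ + 1) ≠ (y + z) ^ (Nat.card F ^ κ + 1) := by
  intro h
  rw [pow_succ (y + z), add_pow_card_pow, pow_succ, pow_succ] at h
  have h0 : y / z = 0 := by
    refine eq_zero_of_pow_eq_neg (κ := κ) hm hq h2 (pow_card_pow_finrank (F := F) _) ?_
    have := pow_ne_zero (Nat.card F ^ κ) hz
    rw [div_pow]
    field_simp
    linear_combination -h
  exact div_ne_zero hy hz h0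

/-- With `z = -(x+y)` in characteristic three, the left side of the second relation is
`-(x-y)^(Q+1)`. -/
theorem eq_of_add_add_eq_zero (h3 : (3 : K) = 0) (hq : Odd (Nat.card F)) {x y z : K}
    (h1 : x + y + z = 0) (h2 : x ^ (Nat.card F ^ κ + 1) + y ^ (Nat.card F ^ κ + 1) +
      z ^ (Nat.card F ^ κ + 1) = 0) : x = y := by
  obtain rfl : z = -(x + y) := by linear_combination h1
  rw [(hq.pow.add_odd odd_one).neg_pow, pow_succ (x + y), add_pow_card_pow, pow_succ, pow_succ] at h2
  have h4 : (x - y) ^ (Nat.card F ^ κ + 1) = 0 := by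
    rw [sub_eq_add_neg, pow_succ, add_pow_card_pow, hq.pow.neg_pow]
    linear_combination -h2 + (x ^ Nat.card F ^ κ * x + y ^ Nat.card F ^ κ * y) * h3
  exact sub_eq_zero.mp (pow_eq_zero_iff (Nat.succ_ne_zero _) |>.mp h4)

theorem not_three_term_relation (hF : Nat.card F = 3) (hm : Odd (Module.finrank F K))
    {a b c : F} (ha : a ≠ 0) (hb : b ≠ 0) (hc : c ≠ 0) {x y z : K} (hx : x ≠ 0) (hy : y ≠ 0)
    (hz : z ≠ 0) (hxy : x ≠ y) (h1 : a • x + b • y + c • z = 0)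
    (h2 : a • x ^ (Nat.card F ^ κ + 1) + b • y ^ (Nat.card F ^ κ + 1) +
      c • z ^ (Nat.card F ^ κ + 1) = 0) : False := by
  have := Fintype.ofFinite F
  have hq : Odd (Nat.card F) := hF ▸ by decide
  have h3F : (3 : F) = 0 := by
    have := FiniteField.cast_card_eq_zero F
    rwa [← Nat.card_eq_fintype_card, hF] at this
  have h3 : (3 : K) = 0 := by rw [← map_ofNat (algebraMap F K) 3, h3F, map_zero]
  have h20 : (2 : K) ≠ 0 := fun h => one_ne_zero (α := K) (by linear_combination h3 - h)
  have hunit : ∀ d : F, d ≠ 0 → d = 1 ∨ d = -1 := fun d hd => by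
    have := FiniteField.pow_card_sub_one_eq_one d hd
    rw [← Nat.card_eq_fintype_card, hF] at this
    exact mul_self_eq_one_iff.mp (by rw [← sq]; exact this)
  -- This settles the six mixed sign patterns, with `w` the term whose sign differs from the other
  -- two.
  have key : ∀ {u v w : K}, u ≠ 0 → v ≠ 0 → u + v = w → u ^ (Nat.card F ^ κ + 1) +
      v ^ (Nat.card F ^ κ + 1) = w ^ (Nat.card F ^ κ + 1) → False := by
    rintro u v w hu hv rfl h
    exact ne_zero_of_add_eq h20 hq hm hu hv h
  rcases hunit a ha with rfl | rfl <;> rcases hunit b hb with rfl | rfl <;>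
    rcases hunit c hc with rfl | rfl <;> simp only [one_smul, neg_smul] at h1 h2
  · exact hxy (eq_of_add_add_eq_zero h3 hq h1 h2)
  · exact key (w := z) hx hy (by linear_combination h1) (by linear_combination h2)
  · exact key (w := y) hx hz (by linear_combination h1) (by linear_combination h2)
  · exact key (w := x) hy hz (by linear_combination -h1) (by linear_combination -h2)
  · exact key (w := x) hy hz (by linear_combination h1) (by linear_combination h2)
  · exact key (w := y) hx hz (by linear_combination -h1) (by linear_combination -h2)
  · exact key (w := z) hx hy (by linear_combination -h1) (by linear_combination -h2)
  · exact hxy (eq_of_add_add_eq_zero (κ := κ) (z := z) h3 hq (by linear_combination -h1)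
      (by linear_combination -h2))

variable {ι : Type*} [Fintype ι] [DecidableEq F]

omit [Finite F] in
theorem sum_support_smul {V : Type*} [AddCommGroup V] [Module F V] (c : ι → F) (v : ι → V) :
    ∑ i with c i ≠ 0, c i • v i = ∑ i, c i • v i :=
  Finset.sum_subset (Finset.filter_subset _ _) fun i _ hi => by
    have : c i = 0 := by simpa using hi
    rw [this, zero_smul]

theorem three_le_hammingNorm {x : ι → K} (hx : Function.Injective x) (hx0 : ∀ i, x i ≠ 0)
    {c : ι → F} (hc : c ≠ 0) (h1 : ∑ i, c i • x i = 0)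
    (h2 : ∑ i, c i • x i ^ (Nat.card F ^ κ + 1) = 0) : 3 ≤ hammingNorm c := by
  classical
  replace h1 := (sum_support_smul c x).trans h1
  replace h2 := (sum_support_smul c fun i => x i ^ (Nat.card F ^ κ + 1)).trans h2
  by_contra! hlt
  have hpos := hammingNorm_pos_iff.mpr hc
  obtain h | h : hammingNorm c = 1 ∨ hammingNorm c = 2 := by omega
  · obtain ⟨i, hi⟩ := Finset.card_eq_one.mp h
    have hci : c i ≠ 0 := by simpa using hi.ge (Finset.mem_singleton_self i)
    rw [hi, Finset.sum_singleton] at h1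
    exact smul_ne_zero hci (hx0 i) h1
  · obtain ⟨i, j, hij, hs⟩ := Finset.card_eq_two.mp h
    have hcj : c j ≠ 0 := by simpa using hs.ge (by simp : j ∈ ({i, j} : Finset ι))
    rw [hs, Finset.sum_pair hij] at h1 h2
    exact hij (hx (eq_of_two_term_relation hcj (hx0 i) (hx0 j) h1 h2))

theorem four_le_hammingNorm (hF : Nat.card F = 3) (hm : Odd (Module.finrank F K)) {x : ι → K}
    (hx : Function.Injective x) (hx0 : ∀ i, x i ≠ 0)
    {c : ι → F} (hc : c ≠ 0) (h1 : ∑ i, c i • x i = 0)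
    (h2 : ∑ i, c i • x i ^ (Nat.card F ^ κ + 1) = 0) : 4 ≤ hammingNorm c := by
  classical
  refine (three_le_hammingNorm hx hx0 hc h1 h2).lt_of_ne fun h => ?_
  obtain ⟨i, j, k, hij, hik, hjk, hs⟩ := Finset.card_eq_three.mp h.symm
  have hne : ∀ l ∈ ({i, j, k} : Finset ι), c l ≠ 0 := fun l hl => by simpa using hs.ge hl
  replace h1 := (sum_support_smul c x).trans h1
  replace h2 := (sum_support_smul c fun i => x i ^ (Nat.card F ^ κ + 1)).trans h2
  rw [hs, Finset.sum_insert (by simp [hij, hik]), Finset.sum_pair hjk,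
    ← add_assoc] at h1 h2
  exact not_three_term_relation hF hm (hne i (by simp)) (hne j (by simp)) (hne k (by simp))
    (hx0 i) (hx0 j) (hx0 k) (hx.ne hij) h1 h2

end Weights

/-! ### Parity checks and words attaining the upper bounds. -/

section Words

variable {F K : Type*} [Field F] [Field K] [Finite F] [Finite K] [Algebra F K] {n κ ε : ℕ} {γ : K}

theorem mem_idealCode_demOstromGen_iff (hn : n + 1 = Nat.card F ^ Module.finrank F K)
    (hγ : IsPrimitiveRoot γ n) (hg : demOstromGen F ε κ γ ∣ X ^ n - 1) (c : Fin n → F) :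
    c ∈ idealCode n (demOstromGen F ε κ γ) ↔ (ε ≠ 0 → ∑ i, c i = 0) ∧
      ∑ i, c i • γ ^ (i : ℕ) = 0 ∧
      ∑ i, c i • (γ ^ (i : ℕ)) ^ (Nat.card F ^ κ + 1) = 0 := by
  simp only [pow_right_comm γ _ (Nat.card F ^ κ + 1)]
  have h1 : aeval (1 : K) (wordPoly n c) = 0 ↔ ∑ i, c i = 0 := by
    rw [aeval_wordPoly, ← (algebraMap F K).injective.eq_iff]
    simp [Algebra.smul_def]
  rw [mem_idealCode_iff hg, ← h1, ← aeval_wordPoly, ← aeval_wordPoly]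
  have hroot := aeval_demOstromGen_eq_zero_iff (F := F) (κ := κ) ε γ
  have hm0 : 0 < Module.finrank F K := Module.finrank_pos
  constructor
  · intro hdvd
    have h : ∀ x : K, aeval x (demOstromGen F ε κ γ) = 0 → aeval x (wordPoly n c) = 0 :=
      fun x hx => aeval_eq_zero_of_dvd_aeval_eq_zero hdvd hx
    exact ⟨fun hε => h 1 ((hroot 1).mpr (Or.inl ⟨hε, rfl⟩)),
      h _ ((hroot _).mpr (Or.inr (Or.inl ⟨0, hm0, by simp⟩))),
      h _ ((hroot _).mpr (Or.inr (Or.inr ⟨0, hm0, by simp⟩)))⟩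
  · rintro ⟨ha, hb, hc⟩
    by_cases hw : wordPoly n c = 0
    · rw [hw]
      exact dvd_zero _
    -- Coefficients lie in `F`, so vanishing at one root spreads over its Frobenius orbit.
    have hconj : ∀ β : K, aeval β (wordPoly n c) = 0 → ∀ t < Module.finrank F K,
        aeval (β ^ Nat.card F ^ t) (wordPoly n c) = 0 := fun β hβ t ht =>
      aeval_eq_zero_of_dvd_aeval_eq_zero (minpoly.dvd F β hβ)
        ((aeval_minpoly_eq_zero_iff β _).mpr ⟨t, ht, rfl⟩)
    have hP : (X ^ n - 1 : F[X]).Separable := separable_X_pow_sub_one hn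
    have hs : ((X ^ n - 1 : F[X]).map (algebraMap F K)).Splits := by
      simpa using X_pow_sub_one_splits hγ
    refine dvd_of_forall_aeval_eq_zero hP hs hg hw fun x hx => ?_
    rcases (hroot x).mp hx with ⟨hε, rfl⟩ | ⟨t, ht, rfl⟩ | ⟨t, ht, rfl⟩
    · exact ha hε
    · exact hconj _ hb t ht
    · exact hconj _ hc t ht

-- Powers of `γ` exhaust the nonzero elements of `K`, including the `q - 1` of `F`.
variable (F) in
theorem exists_embedding_subfield (hn : n + 1 = Nat.card F ^ Module.finrank F K) (hn0 : n ≠ 0)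
    (hγ : IsPrimitiveRoot γ n) {r : ℕ} (hr : r < Nat.card F) :
    ∃ (l : Fin r → F) (e : Fin r ↪ Fin n), ∀ k, γ ^ (e k : ℕ) = algebraMap F K (l k) := by
  classical
  have := Fintype.ofFinite F
  have : NeZero n := ⟨hn0⟩
  obtain ⟨l⟩ := Function.Embedding.nonempty_of_card_le (α := Fin r) (β := Fˣ) (by
    rw [Fintype.card_fin, Fintype.card_units, ← Nat.card_eq_fintype_card]
    omega)
  have hex : ∀ k, ∃ i : Fin n, γ ^ (i : ℕ) = algebraMap F K (l k) := fun k => by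
    have hne : algebraMap F K (l k) ≠ 0 := by simp
    obtain ⟨i, hi, h⟩ := hγ.eq_pow_of_pow_eq_one (ξ := algebraMap F K (l k)) (by
      refine mul_right_cancel₀ hne ?_
      rw [← pow_succ, hn, pow_card_pow_finrank, one_mul])
    exact ⟨⟨i, hi⟩, h⟩
  choose e he using hex
  refine ⟨fun k => l k, ⟨e, fun a b hab => ?_⟩, he⟩
  have h := he a
  rw [hab, he b] at h
  exact l.injective (Units.ext ((algebraMap F K).injective h.symm))

variable [DecidableEq F]

/-- Three columns over `F` come from `F × F` through the inclusion `T`, hence are dependent. -/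
theorem exists_word_le_three (hn : n + 1 = Nat.card F ^ Module.finrank F K) (hn0 : n ≠ 0)
    (hγ : IsPrimitiveRoot γ n) (hq : 3 < Nat.card F) :
    ∃ c : Fin n → F, c ≠ 0 ∧ hammingNorm c ≤ 3 ∧ ∑ i, c i • γ ^ (i : ℕ) = 0 ∧
      ∑ i, c i • (γ ^ (i : ℕ)) ^ (Nat.card F ^ κ + 1) = 0 := by
  obtain ⟨l, e, he⟩ := exists_embedding_subfield F hn hn0 hγ hq
  let v : Fin n → K × K := fun i => (γ ^ (i : ℕ), (γ ^ (i : ℕ)) ^ (Nat.card F ^ κ + 1))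
  let T : F × F →ₗ[F] K × K := (Algebra.linearMap F K).prodMap (Algebra.linearMap F K)
  have hv : v ∘ e = T ∘ fun k => (l k, l k ^ (Nat.card F ^ κ + 1)) := by
    funext k
    simp [v, T, he]
  obtain ⟨c, hc0, hc, hsum⟩ := exists_word_of_not_linearIndependent e v (fun hli => by
    rw [hv] at hli
    have := (LinearIndependent.of_comp T hli).fintype_card_le_finrank
    simp at this)
  rw [Fintype.card_fin] at hc
  refine ⟨c, hc0, hc, ?_, ?_⟩
  · simpa [v, Prod.fst_sum] using congrArg Prod.fst hsum
  · simpa [v, Prod.snd_sum] using congrArg Prod.snd hsum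

theorem exists_word_le_four (hn : n + 1 = Nat.card F ^ Module.finrank F K) (hn0 : n ≠ 0)
    (hγ : IsPrimitiveRoot γ n) (hq : 4 < Nat.card F) :
    ∃ c : Fin n → F, c ≠ 0 ∧ hammingNorm c ≤ 4 ∧ ∑ i, c i = 0 ∧ ∑ i, c i • γ ^ (i : ℕ) = 0 ∧
      ∑ i, c i • (γ ^ (i : ℕ)) ^ (Nat.card F ^ κ + 1) = 0 := by
  obtain ⟨l, e, he⟩ := exists_embedding_subfield F hn hn0 hγ hq
  let v : Fin n → F × K × K := fun i => (1, γ ^ (i : ℕ), (γ ^ (i : ℕ)) ^ (Nat.card F ^ κ + 1))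
  let T : F × F × F →ₗ[F] F × K × K :=
    LinearMap.id.prodMap ((Algebra.linearMap F K).prodMap (Algebra.linearMap F K))
  have hv : v ∘ e = T ∘ fun k => (1, l k, l k ^ (Nat.card F ^ κ + 1)) := by
    funext k
    simp [v, T, he]
  obtain ⟨c, hc0, hc, hsum⟩ := exists_word_of_not_linearIndependent e v (fun hli => by
    rw [hv] at hli
    have := (LinearIndependent.of_comp T hli).fintype_card_le_finrank
    simp at this)
  rw [Fintype.card_fin] at hc
  refine ⟨c, hc0, hc, ?_, ?_, ?_⟩
  · simpa [v, Prod.fst_sum] using congrArg Prod.fst hsum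
  · simpa [v, Prod.snd_sum, Prod.fst_sum] using congrArg (fun p => p.2.1) hsum
  · simpa [v, Prod.snd_sum] using congrArg (fun p => p.2.2) hsum

theorem exists_ternary_word_le_four (hF : Nat.card F = 3) (hn : n + 1 = Nat.card K)
    (hn5 : 5 ≤ n) :
    ∃ c : Fin n → F, c ≠ 0 ∧ hammingNorm c ≤ 4 ∧ ∑ i, c i • γ ^ (i : ℕ) = 0 ∧
      ∑ i, c i • (γ ^ (i : ℕ)) ^ (Nat.card F ^ κ + 1) = 0 := by
  obtain ⟨c, hc0, hc, hsum⟩ := exists_word_hammingNorm_le_four (F := F) (V := K × K)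
    (fun i : Fin n => (γ ^ (i : ℕ), (γ ^ (i : ℕ)) ^ (Nat.card F ^ κ + 1))) (by
      obtain ⟨k, rfl⟩ := Nat.exists_eq_add_of_le hn5
      -- The count needs `2n(n-1) > (n+1)^2`, true from `n = 5` on.
      rw [Nat.card_prod, ← hn, hF, show 5 + k - 1 = 4 + k by omega]
      norm_num
      nlinarith)
  refine ⟨c, hc0, hc, ?_, ?_⟩
  · simpa [Prod.fst_sum] using congrArg Prod.fst hsum
  · simpa [Prod.snd_sum] using congrArg Prod.snd hsum

theorem exists_ternary_word_le_five (hF : Nat.card F = 3) (hn : n + 1 = Nat.card K)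
    (hn8 : 8 ≤ n) :
    ∃ c : Fin n → F, c ≠ 0 ∧ hammingNorm c ≤ 5 ∧ ∑ i, c i = 0 ∧ ∑ i, c i • γ ^ (i : ℕ) = 0 ∧
      ∑ i, c i • (γ ^ (i : ℕ)) ^ (Nat.card F ^ κ + 1) = 0 := by
  obtain ⟨k, rfl⟩ := Nat.exists_eq_add_of_le' hn8
  obtain ⟨c, hc0, hc, hsum, hsum1⟩ := exists_word_hammingNorm_le_five (F := F) (V := K × K)
    (N := k + 7)
    (fun i : Fin (k + 8) => (γ ^ (i : ℕ), (γ ^ (i : ℕ)) ^ (Nat.card F ^ κ + 1))) (by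
      -- With one column spent, the count needs `2(n-1)(n-2) > (n+1)^2`, true from `n = 8` on.
      rw [Nat.card_prod, ← hn, hF, show k + 7 - 1 = k + 6 by omega]
      norm_num
      nlinarith)
  refine ⟨c, hc0, hc, hsum1, ?_, ?_⟩
  · simpa [Prod.fst_sum] using congrArg Prod.fst hsum
  · simpa [Prod.snd_sum] using congrArg Prod.snd hsum

end Words

/-! ### The minimum distance and the main theorem. -/

open Classical in
theorem exists_isMinDist {F : Type*} [Field F] {n L U : ℕ} {D : Submodule F (Fin n → F)}
    (hL : ∀ c ∈ D, c ≠ 0 → L ≤ hammingNorm c) (hU : ∃ c ∈ D, c ≠ 0 ∧ hammingNorm c ≤ U) :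
    ∃ d, IsMinDist D d ∧ L ≤ d ∧ d ≤ U := by
  obtain ⟨c, hc, hc0, hcU⟩ := hU
  have hex : ∃ w, ∃ c ∈ D, c ≠ 0 ∧ hammingNorm c = w := ⟨_, c, hc, hc0, rfl⟩
  refine ⟨Nat.find hex, ⟨Nat.find_spec hex, fun w hw => Nat.find_min' hex hw⟩, ?_,
    (Nat.find_min' hex ⟨c, hc, hc0, rfl⟩).trans hcU⟩
  obtain ⟨c', hc', hc0', h⟩ := Nat.find_spec hex
  exact h ▸ hL c' hc' hc0'

theorem mainTheorem8 (p q m κ : ℕ) (hp : p.Prime) (hp2 : p ≠ 2) (hq : ∃ e : ℕ, 0 < e ∧ q = p ^ e)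
    (hm : Odd m) (hqm : ¬ (q = 3 ∧ m = 1))
    {F K : Type*} [Field F] [Field K] [Finite F] [Finite K] [Algebra F K]
    (hF : Nat.card F = q) (hK : Nat.card K = q ^ m)
    (α : Kˣ) (hα : ∀ x : Kˣ, x ∈ Subgroup.zpowers α) :
    let n : ℕ := q ^ m - 1
    let Cs : Submodule F (Fin n → F) := seqCode n (assocSeq F (demOstrom K q κ) (α : K))
    IsCyclicCode Cs ∧
    IsGeneratorPoly Cs ((X - 1) ^ Np p m * minpoly F ((α⁻¹ : Kˣ) : K) *
      minpoly F (((α ^ (q ^ κ + 1))⁻¹ : Kˣ) : K)) ∧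
    ∃ k d : ℕ, k + 2 * m + Np p m = n ∧ HasParams Cs k d ∧
      (q = 3 → p ∣ m → d = 4) ∧
      (q = 3 → ¬ p ∣ m → 4 ≤ d ∧ d ≤ 5) ∧
      (3 < q → p ∣ m → d = 3) ∧
      (3 < q → ¬ p ∣ m → 3 ≤ d ∧ d ≤ 4) := by
  classical
  intro n Cs
  have hp3 : 3 ≤ p := by
    have := hp.two_le
    omega
  have hpodd : Odd p := hp.odd_of_ne_two hp2
  obtain ⟨e, he, hqe⟩ := hq
  have hqodd : Odd q := hqe ▸ hpodd.pow
  have hq3 : 3 ≤ q := hqe ▸ hp3.trans (Nat.le_self_pow he.ne' p)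
  have hn : n + 1 = q ^ m := Nat.sub_add_cancel (Nat.one_le_pow _ _ (by omega))
  -- For `q = 3` the excluded pair `(3, 1)` leaves `m ≥ 3`; otherwise `q ≥ 5` as `q` is odd.
  have hnlarge : (q = 3 → 8 ≤ n) ∧ 4 ≤ n := by
    rcases hq3.eq_or_lt with h3 | h3
    · have hm3 : 3 ≤ m := by
        obtain ⟨j, rfl⟩ := hm
        by_contra hlt
        exact hqm ⟨h3.symm, by omega⟩
      have h27 : 3 ^ 3 ≤ 3 ^ m := Nat.pow_le_pow_right (by norm_num) hm3
      rw [← h3] at hn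
      omega
    · have h5 : q ≤ q ^ m := Nat.le_self_pow hm.pos.ne' q
      obtain ⟨j, hj⟩ := hqodd
      omega
  have hfr : Module.finrank F K = m := by
    have h := Module.natCard_eq_pow_finrank (K := F) (V := K)
    rw [hK, hF] at h
    exact (Nat.pow_right_injective (by omega : 2 ≤ q) h).symm
  have := Fintype.ofFinite F
  have : Fact p.Prime := ⟨hp⟩
  have hchar : CharP F p :=
    charP_of_card_eq_prime_pow (f := e) (by rw [← Nat.card_eq_fintype_card, hF, hqe])
  have h2 : (2 : K) ≠ 0 := by
    rw [← map_ofNat (algebraMap F K) 2, _root_.map_ne_zero, ← Nat.cast_ofNat, Ne, CharP.cast_eq_zero_iff F p]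
    intro h
    have := Nat.le_of_dvd two_pos h
    omega
  have hord : orderOf α = n := by
    rw [orderOf_eq_card_of_forall_mem_zpowers hα, Nat.card_units, hK]
  have hα0 : (α : K) ≠ 0 := α.ne_zero
  have hprim : IsPrimitiveRoot (α : K) n :=
    IsPrimitiveRoot.coe_units_iff.mpr (hord ▸ IsPrimitiveRoot.orderOf α)
  have hNp : Np p m ≤ 1 := by
    rw [Np]
    split_ifs <;> omega
  have hNp0 : Np p m ≠ 0 ↔ (m : F) ≠ 0 := by
    rw [Ne, Ne, CharP.cast_eq_zero_iff F p, Np]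
    split_ifs with h <;> simp [h]
  clear_value n
  subst hF hfr
  have hgen : (X - 1) ^ Np p (Module.finrank F K) * minpoly F ((α⁻¹ : Kˣ) : K) *
      minpoly F (((α ^ (Nat.card F ^ κ + 1))⁻¹ : Kˣ) : K) =
      demOstromGen F (Np p (Module.finrank F K)) κ (α : K)⁻¹ := by
    rw [demOstromGen, Units.val_inv_eq_inv_val, Units.val_inv_eq_inv_val, Units.val_pow_eq_pow_val,
      inv_pow]
  have hdvd := demOstromGen_dvd (κ := κ) h2 hqodd hm hn (by omega) hNp hprim.inv
  have hCs : Cs = idealCode n (demOstromGen F (Np p (Module.finrank F K)) κ (α : K)⁻¹) := by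
    rw [← seqGenPoly_eq h2 hqodd hm hn (by omega) hq3 hprim hα0 hNp hNp0]
    rfl
  clear_value Cs
  subst hCs
  rw [hgen]
  refine ⟨isCyclicCode_idealCode hdvd, ⟨demOstromGen_monic _ _, hdvd, rfl⟩, ?_⟩
  have hmem := mem_idealCode_demOstromGen_iff hn hprim.inv hdvd
  have hdim := finrank_idealCode (by omega) hdvd
  rw [natDegree_demOstromGen hq3 hm hn _ hprim.inv (inv_ne_zero hα0)] at hdim
  have hinj : Function.Injective fun i : Fin n => (α : K)⁻¹ ^ (i : ℕ) := fun i j hij =>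
    Fin.ext (hprim.inv.pow_inj i.2 j.2 hij)
  have hne : ∀ i : Fin n, (α : K)⁻¹ ^ (i : ℕ) ≠ 0 := fun i => pow_ne_zero _ (inv_ne_zero hα0)
  have hlow3 : ∀ c ∈ idealCode n (demOstromGen F (Np p (Module.finrank F K)) κ (α : K)⁻¹), c ≠ 0 →
      3 ≤ hammingNorm c := fun c hc hc0 =>
    three_le_hammingNorm hinj hne hc0 ((hmem c).mp hc).2.1 ((hmem c).mp hc).2.2
  have hlow4 : Nat.card F = 3 →
      ∀ c ∈ idealCode n (demOstromGen F (Np p (Module.finrank F K)) κ (α : K)⁻¹), c ≠ 0 →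
      4 ≤ hammingNorm c := fun hF3 c hc hc0 =>
    four_le_hammingNorm hF3 hm hinj hne hc0 ((hmem c).mp hc).2.1 ((hmem c).mp hc).2.2
  suffices h : ∃ d, IsMinDist (idealCode n (demOstromGen F (Np p (Module.finrank F K)) κ (α : K)⁻¹))
      d ∧ (Nat.card F = 3 → p ∣ Module.finrank F K → d = 4) ∧
      (Nat.card F = 3 → ¬ p ∣ Module.finrank F K → 4 ≤ d ∧ d ≤ 5) ∧
      (3 < Nat.card F → p ∣ Module.finrank F K → d = 3) ∧
      (3 < Nat.card F → ¬ p ∣ Module.finrank F K → 3 ≤ d ∧ d ≤ 4) by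
    obtain ⟨d, hd, hd'⟩ := h
    exact ⟨_, d, by omega, ⟨rfl, hd⟩, hd'⟩
  by_cases hpm : p ∣ Module.finrank F K
  · have hN0 : Np p (Module.finrank F K) = 0 := if_pos hpm
    rcases hq3.eq_or_lt with h3 | h3
    · obtain ⟨c, hc0, hc, hc1, hc2⟩ := exists_ternary_word_le_four (κ := κ) (γ := (α : K)⁻¹) h3.symm
        (hn.trans hK.symm) (by have := hnlarge.1 h3.symm; omega)
      obtain ⟨d, hd, hd1, hd2⟩ := exists_isMinDist (hlow4 h3.symm)
        ⟨c, (hmem c).mpr ⟨fun h => absurd hN0 h, hc1, hc2⟩, hc0, hc⟩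
      exact ⟨d, hd, fun _ _ => by omega, fun _ h => absurd hpm h, fun h => by omega,
        fun h => by omega⟩
    · obtain ⟨c, hc0, hc, hc1, hc2⟩ := exists_word_le_three (κ := κ) hn (by omega) hprim.inv h3
      obtain ⟨d, hd, hd1, hd2⟩ := exists_isMinDist hlow3
        ⟨c, (hmem c).mpr ⟨fun h => absurd hN0 h, hc1, hc2⟩, hc0, hc⟩
      exact ⟨d, hd, fun h => by omega, fun h => by omega, fun _ _ => by omega,
        fun _ h => absurd hpm h⟩
  · rcases hq3.eq_or_lt with h3 | h3
    · obtain ⟨c, hc0, hc, hc1, hc2⟩ := exists_ternary_word_le_five (κ := κ) (γ := (α : K)⁻¹) h3.symm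
        (hn.trans hK.symm) (hnlarge.1 h3.symm)
      obtain ⟨d, hd, hd1, hd2⟩ := exists_isMinDist (hlow4 h3.symm)
        ⟨c, (hmem c).mpr ⟨fun _ => hc1, hc2⟩, hc0, hc⟩
      exact ⟨d, hd, fun _ h => absurd h hpm, fun _ _ => ⟨hd1, hd2⟩, fun h => by omega,
        fun h => by omega⟩
    · have h4 : 4 < Nat.card F := by
        obtain ⟨j, hj⟩ := hqodd
        omega
      obtain ⟨c, hc0, hc, hc1, hc2⟩ := exists_word_le_four (κ := κ) hn (by omega) hprim.inv h4
      obtain ⟨d, hd, hd1, hd2⟩ := exists_isMinDist hlow3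
        ⟨c, (hmem c).mpr ⟨fun _ => hc1, hc2⟩, hc0, hc⟩
      exact ⟨d, hd, fun h => by omega, fun h => by omega, fun _ h => absurd h hpm,
        fun _ _ => ⟨hd1, hd2⟩⟩
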